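/- Let $n\ge 1$ be an integer, $n-1<\alpha\le n$, let $m\ge 0$ be an integer, $r\in\mathbb R$, and let $(w_{k,r})_{k\ge 0}$ be a sequence of real numbers with generating function $W(z)=\sum_{k=0}^\infty w_{k,r}z^k$. For $h>0$ put $$\Delta_{\mp h,r}^{\alpha} f(x)=\frac1{h^\alpha}\sum_{k=0}^\infty w_{k,r}\,f\bigl(x\mp(k-r)h\bigr),$$ and let the left and right fractional derivatives of order $\alpha$ be the Grünwald–Letnikov ones, $${}_{-\infty}D_x^\alpha f(x)=\lim_{h\to0^+}\frac1{h^\alpha}\sum_{k=0}^\infty(-1)^k\binom{\alpha}{k}f(x-kh),\qquad {}_{x}D_\infty^\alpha f(x)=\lim_{h\to0^+}\frac1{h^\alpha}\sum_{k=0}^\infty(-1)^k\binom{\alpha}{k}f(x+kh)$$ (all series are limits of partial sums). Assume that $W$ gives a consistent approximation: for every $f\in C^{m+n+1}(\mathbb R)$ with $f^{(k)}\in L^1(\mathbb R)$ for $0\le k\le m+n+1$ and every $x\in\mathbb R$, whenever the left (resp. right) fractional derivative of $f$ at $x$ exists, the series defining $\Delta^\alpha_{-h,r}f(x)$ (resp.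 $\Delta^\alpha_{+h,r}f(x)$) converges for all sufficiently small $h>0$, and $\Delta^\alpha_{-h,r}f(x)\to{}_{-\infty}D^\alpha_xf(x)$ (resp. $\Delta^\alpha_{+h,r}f(x)\to{}_xD^\alpha_\infty f(x)$) as $h\to0^+$. (This is the case in particular if the error is $O(h^p)$ for some $p\ge1$.) Then: 1. $W(z)$ converges for $|z|<1$ and $W(1)=0$ in the sense that $\lim_{t\to1^-}W(t)=0$. If the series $\sum_k w_{k,r}$ converges, then also the value of the series $W$ at $1$ is $0$. 2. If the series $\sum_k w_{k,r}$ converges, then $\sum_{k=0}^\infty w_{k,r}=0$. 3. If the series $\sum_k w_{k,r}$ converges, then for every constant function $C$ the approximated fractional derivatives vanish, $\Delta^\alpha_{\mp h,r}C=0$ at every $x\in\mathbb R$ for every $h>0$, and so do their limits as $h\to0^+$. In all cases the left and right fractional derivatives of order $\alpha$ of a constant exist and are zero. -/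

import Mathlib

open Filter Topology Asymptotics MeasureTheory SummationFilter

noncomputable section

namespace Grunwald

/-- Left Grünwald type operator with weights `w` and real shift `r`:
`h^{-α} ∑_{k ≥ 0} w_k f(x - (k - r) h)`. The series is the limit of its partial sums. -/
def leftOp (α : ℝ) (w : ℕ → ℝ) (r h : ℝ) (f : ℝ → ℝ) (x : ℝ) : ℝ :=
  1 / h ^ α * ∑'[conditional ℕ] k : ℕ, w k * f (x - ((k : ℝ) - r) * h)

/-- Right Grünwald type operator: `h^{-α} ∑_{k ≥ 0} w_k f(x + (k - r) h)`. -/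
def rightOp (α : ℝ) (w : ℕ → ℝ) (r h : ℝ) (f : ℝ → ℝ) (x : ℝ) : ℝ :=
  1 / h ^ α * ∑'[conditional ℕ] k : ℕ, w k * f (x + ((k : ℝ) - r) * h)

/-- The series in `leftOp` converges (its partial sums have a limit). -/
def LeftConv (w : ℕ → ℝ) (r h : ℝ) (f : ℝ → ℝ) (x : ℝ) : Prop :=
  Summable (fun k : ℕ => w k * f (x - ((k : ℝ) - r) * h)) (conditional ℕ)

/-- The series in `rightOp` converges (its partial sums have a limit). -/
def RightConv (w : ℕ → ℝ) (r h : ℝ) (f : ℝ → ℝ) (x : ℝ) : Prop :=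
  Summable (fun k : ℕ => w k * f (x + ((k : ℝ) - r) * h)) (conditional ℕ)

/-- `lim_{h → 0+} leftOp α w r h f x = L`, with convergent series for all small `h > 0`. -/
def HasLeftLimit (α : ℝ) (w : ℕ → ℝ) (r : ℝ) (f : ℝ → ℝ) (x L : ℝ) : Prop :=
  (∀ᶠ h in 𝓝[>] (0 : ℝ), LeftConv w r h f x) ∧
    Tendsto (fun h => leftOp α w r h f x) (𝓝[>] 0) (𝓝 L)

/-- `lim_{h → 0+} rightOp α w r h f x = L`, with convergent series for all small `h > 0`. -/
def HasRightLimit (α : ℝ) (w : ℕ → ℝ) (r : ℝ) (f : ℝ → ℝ) (x L : ℝ) : Prop :=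
  (∀ᶠ h in 𝓝[>] (0 : ℝ), RightConv w r h f x) ∧
    Tendsto (fun h => rightOp α w r h f x) (𝓝[>] 0) (𝓝 L)

/-- Grünwald coefficients `(-1)^k binom(α, k)`, where
`binom(α, k) = α (α - 1) ⋯ (α - k + 1) / k!`. -/
def glCoeff (α : ℝ) (k : ℕ) : ℝ := (-1) ^ k * Ring.choose α k

/-- The left Grünwald-Letnikov derivative of order `α` of `f` at `x` exists and equals `L`. -/
def HasLeftGLDeriv (α : ℝ) (f : ℝ → ℝ) (x L : ℝ) : Prop :=
  HasLeftLimit α (glCoeff α) 0 f x L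

/-- The right Grünwald-Letnikov derivative of order `α` of `f` at `x` exists and equals `L`. -/
def HasRightGLDeriv (α : ℝ) (f : ℝ → ℝ) (x L : ℝ) : Prop :=
  HasRightLimit α (glCoeff α) 0 f x L

/-- Admissible functions: `f ∈ C^s(ℝ)` with `f, f', …, f^(s)` all in `L¹(ℝ)`. -/
def Admissible (s : ℕ) (f : ℝ → ℝ) : Prop :=
  ContDiff ℝ s f ∧ ∀ k ≤ s, Integrable (iteratedDeriv k f) volume

/-- Consistency (approximation in the sense of Grünwald): with weights `w` and shift `r`, the left
and right operators converge, as `h → 0+`, to the left and right fractional derivatives of order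
`α`, at every point, for every admissible function. -/
def Consistent (α : ℝ) (w : ℕ → ℝ) (r : ℝ) (s : ℕ) : Prop :=
  ∀ f : ℝ → ℝ, Admissible s f → ∀ x L : ℝ,
    (HasLeftGLDeriv α f x L → HasLeftLimit α w r f x L) ∧
    (HasRightGLDeriv α f x L → HasRightLimit α w r f x L)

/-- Approximation of order `p`: the error is `O(h^p)` as `h → 0+`. -/
def ApproximatesWithOrder (α : ℝ) (w : ℕ → ℝ) (r : ℝ) (s p : ℕ) : Prop :=
  ∀ f : ℝ → ℝ, Admissible s f → ∀ x L : ℝ,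
    (HasLeftGLDeriv α f x L → (∀ᶠ h in 𝓝[>] (0 : ℝ), LeftConv w r h f x) ∧
      (fun h => leftOp α w r h f x - L) =O[𝓝[>] (0 : ℝ)] fun h => h ^ p) ∧
    (HasRightGLDeriv α f x L → (∀ᶠ h in 𝓝[>] (0 : ℝ), RightConv w r h f x) ∧
      (fun h => rightOp α w r h f x - L) =O[𝓝[>] (0 : ℝ)] fun h => h ^ p)

/-- An approximation of any order `p ≥ 1` is consistent, so a theorem that assumes `Consistent`
covers the approximations of every positive order. -/
theorem ApproximatesWithOrder.consistent {α : ℝ} {w : ℕ → ℝ} {r : ℝ} {s p : ℕ} (hp : 1 ≤ p)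
    (H : ApproximatesWithOrder α w r s p) : Consistent α w r s := by
  have h0 : Tendsto (fun h : ℝ => h ^ p) (𝓝[>] 0) (𝓝 0) := by
    have : Tendsto (fun h : ℝ => h ^ p) (𝓝 0) (𝓝 ((0 : ℝ) ^ p)) := (continuous_pow p).tendsto 0
    rw [zero_pow (by omega)] at this
    exact this.mono_left nhdsWithin_le_nhds
  intro f hf x L
  refine ⟨fun hL => ?_, fun hL => ?_⟩
  · obtain ⟨h1, h2⟩ := (H f hf x L).1 hL
    exact ⟨h1, tendsto_sub_nhds_zero_iff.1 (h2.trans_tendsto h0)⟩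
  · obtain ⟨h1, h2⟩ := (H f hf x L).2 hL
    exact ⟨h1, tendsto_sub_nhds_zero_iff.1 (h2.trans_tendsto h0)⟩

/-- Generating function `W(z) = ∑_{k ≥ 0} w_k z^k` (limit of partial sums). -/
def genFun (w : ℕ → ℝ) (z : ℂ) : ℂ := ∑'[conditional ℕ] k : ℕ, (w k : ℂ) * z ^ k

end Grunwald

end

namespace Grunwald

/-! ### Conditional sums over `ℕ` -/

/-! Consistency is tested on one function, `cutExp`: the exponential itself is not integrable, but
the left operator only samples to the left of `x + r * h`, so a cutoff on the right costs nothing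
when `x + r * h ≤ 0`. There the operator acts on the exponential as multiplication by `h^{-α} e^{rh}
W(e^{-h})`. For the Grünwald weights the factor is `((1 - e^{-h}) / h)^α → 1`, so the left
derivative is `exp x`. Consistency then forces convergence of `W` at `e^{-h}` and `h^{-α} e^{rh}
W(e^{-h}) → 1`, hence `W(e^{-h}) → 0` because `α > 0` (`Consistent.genFun_exp_neg`). Since `e^{-h} →
1`, this gives convergence in the disc and, with `t = e^{-h}`, the limit at `1`.

If the weights are summable, Abel's limit theorem identifies their sum with that limit. On a
constant `C` both operators give `C h^{-α} ∑ w_k`, which settles the constants; the Grünwald weights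
sum to zero because their partial sums are the coefficients of order `α - 1 > -1`, which tend to
zero. -/

theorem hasSum_conditional_nat_iff {E : Type*} [AddCommMonoid E] [TopologicalSpace E]
    {f : ℕ → E} {a : E} :
    HasSum f a (conditional ℕ) ↔
      Tendsto (fun N => ∑ k ∈ Finset.range N, f k) atTop (𝓝 a) := by
  rw [HasSum, conditional_filter_eq_map_range, tendsto_map'_iff]
  rfl

/-- Comparison with a geometric series: mere convergence of partial sums at `s` gives absolute
convergence strictly inside the circle of radius `|s|`. -/
theorem summable_of_summable_conditional_pow {w : ℕ → ℝ} {s : ℝ} {z : ℂ}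
    (hs : Summable (fun k => w k * s ^ k) (conditional ℕ)) (hz : ‖z‖ < |s|) :
    Summable fun k : ℕ => (w k : ℂ) * z ^ k := by
  obtain ⟨a, ha⟩ := hs
  have hc := (Complex.continuous_ofReal.tendsto a).comp (hasSum_conditional_nat_iff.1 ha)
  refine summable_powerSeries_of_norm_lt (w := (s : ℂ)) ?_ (by simpa using hz)
  have he : (fun N => ∑ k ∈ Finset.range N, (w k : ℂ) * (s : ℂ) ^ k) =
      Complex.ofReal ∘ fun N => ∑ k ∈ Finset.range N, w k * s ^ k := by
    ext N
    simp
  rw [he]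
  exact hc.cauchySeq

theorem genFun_ofReal {w : ℕ → ℝ} {t a : ℝ}
    (ha : HasSum (fun k => w k * t ^ k) a (conditional ℕ)) : genFun w (t : ℂ) = a := by
  have hc : HasSum (fun k => (w k : ℂ) * (t : ℂ) ^ k) (a : ℂ) (conditional ℕ) := by
    refine hasSum_conditional_nat_iff.2 ?_
    convert (Complex.continuous_ofReal.tendsto a).comp (hasSum_conditional_nat_iff.1 ha) using 2
    simp
  exact hc.tsum_eq

/-! ### Grünwald coefficients -/

/-- Pascal's rule makes the sum telescope; on generating functions this is `(1 - z)^α / (1 - z) = (1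
- z)^(α - 1)`. -/
theorem sum_range_succ_glCoeff (α : ℝ) (N : ℕ) :
    ∑ k ∈ Finset.range (N + 1), glCoeff α k = glCoeff (α - 1) N := by
  induction N with
  | zero => simp [glCoeff]
  | succ N ih =>
    have h := Ring.choose_succ_succ (α - 1) N
    rw [sub_add_cancel] at h
    rw [Finset.sum_range_succ, ih, glCoeff, glCoeff, glCoeff, h, pow_succ]
    ring

theorem glCoeff_succ (β : ℝ) (N : ℕ) :
    glCoeff β (N + 1) = glCoeff β N * (1 - (β + 1) * (1 / ((N : ℝ) + 1))) := by
  have h := Ring.choose_smul_choose β (Nat.le_succ N)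
  simp only [Nat.succ_eq_add_one, Nat.choose_succ_self_right, nsmul_eq_mul, Nat.add_sub_cancel_left,
    Ring.choose_one_right] at h
  have hN : (N : ℝ) + 1 ≠ 0 := by positivity
  have h' : Ring.choose β (N + 1) = Ring.choose β N * (β - N) / ((N : ℝ) + 1) := by
    rw [eq_div_iff hN, ← h]
    push_cast
    ring
  rw [glCoeff, glCoeff, h', pow_succ]
  field_simp
  ring

/-- The Grünwald coefficients of order `β > -1` tend to zero. -/
theorem tendsto_glCoeff {β : ℝ} (hβ : -1 < β) : Tendsto (glCoeff β) atTop (𝓝 0) := by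
  have hα : 0 < β + 1 := by linarith
  set H : ℕ → ℝ := fun N => ∑ i ∈ Finset.range N, 1 / ((i : ℝ) + 1) with hH
  -- From `N₀` on, the ratio `1 - (β + 1) / (N + 1)` is nonnegative and at most `exp (-(β + 1) / (N
  -- + 1))`. The product of these bounds tends to zero because the harmonic series diverges.
  obtain ⟨N₀, hN₀⟩ := exists_nat_ge (β + 1)
  have hstep : ∀ N ≥ N₀, |glCoeff β (N + 1)| ≤
      |glCoeff β N| * Real.exp (-((β + 1) * (1 / ((N : ℝ) + 1)))) := by
    intro N hN
    have hN' : (N₀ : ℝ) ≤ N := by exact_mod_cast hN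
    have h1 : (β + 1) * (1 / ((N : ℝ) + 1)) ≤ 1 := by
      rw [mul_one_div, div_le_one (by positivity)]
      linarith
    rw [glCoeff_succ, abs_mul, abs_of_nonneg (by linarith : 0 ≤ 1 - (β + 1) * (1 / ((N : ℝ) + 1)))]
    exact mul_le_mul_of_nonneg_left (Real.one_sub_le_exp_neg _) (abs_nonneg _)
  set M := |glCoeff β N₀| * Real.exp ((β + 1) * H N₀)
  have hbound : ∀ N ≥ N₀, |glCoeff β N| ≤ M * Real.exp (-((β + 1) * H N)) := by
    intro N hN
    induction N, hN using Nat.le_induction with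
    | base => rw [mul_assoc, ← Real.exp_add]; simp
    | succ N hN ih =>
      refine (hstep N hN).trans ((mul_le_mul_of_nonneg_right ih (Real.exp_pos _).le).trans_eq ?_)
      rw [mul_assoc, ← Real.exp_add]
      simp only [hH, Finset.sum_range_succ]
      ring_nf
  have hlim : Tendsto (fun N => M * Real.exp (-((β + 1) * H N))) atTop (𝓝 0) := by
    have h1 : Tendsto (fun N => (β + 1) * H N) atTop atTop :=
      Real.tendsto_sum_range_one_div_nat_succ_atTop.const_mul_atTop hα
    simpa using (Real.tendsto_exp_neg_atTop_nhds_zero.comp h1).const_mul M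
  exact squeeze_zero_norm' (eventually_atTop.2 ⟨N₀, hbound⟩) hlim

theorem hasSum_glCoeff {α : ℝ} (hα : 0 < α) : HasSum (glCoeff α) 0 (conditional ℕ) := by
  rw [hasSum_conditional_nat_iff, ← tendsto_add_atTop_iff_nat 1]
  simp only [sum_range_succ_glCoeff]
  exact tendsto_glCoeff (by linarith)

/-- The binomial series `∑ (-1)^k binom(α, k) t^k = (1 - t)^α`. -/
theorem hasSum_glCoeff_mul_pow (α : ℝ) {t : ℝ} (ht : |t| < 1) :
    HasSum (fun k => glCoeff α k * t ^ k) ((1 - t) ^ α) := by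
  have h := (Real.one_add_rpow_hasFPowerSeriesOnBall_zero (a := α)).hasSum (y := -t) (by
    rw [← ENNReal.ofReal_one, Metric.eball_ofReal]
    simpa using ht)
  have hval : (1 + (0 + -t)) ^ α = (1 - t) ^ α := by rw [zero_add, sub_eq_add_neg]
  have hterm : (fun k => (binomialSeries ℝ α k) fun _ => -t) = fun k => glCoeff α k * t ^ k := by
    ext k
    rw [binomialSeries_apply, glCoeff, List.ofFn_const, List.prod_replicate, smul_eq_mul,
      neg_pow t]
    ring
  rwa [hval, hterm] at h

/-! ### Constant functions -/

theorem hasSum_mul_const {w : ℕ → ℝ} (hw : HasSum w 0 (conditional ℕ)) (C : ℝ) :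
    HasSum (fun k => w k * C) 0 (conditional ℕ) := by
  simpa using hw.mul_right C

theorem leftConv_const {w : ℕ → ℝ} (hw : HasSum w 0 (conditional ℕ)) (r h C x : ℝ) :
    LeftConv w r h (fun _ => C) x :=
  (hasSum_mul_const hw C).summable

theorem rightConv_const {w : ℕ → ℝ} (hw : HasSum w 0 (conditional ℕ)) (r h C x : ℝ) :
    RightConv w r h (fun _ => C) x :=
  (hasSum_mul_const hw C).summable

theorem leftOp_const {w : ℕ → ℝ} (hw : HasSum w 0 (conditional ℕ)) (α r h C x : ℝ) :
    leftOp α w r h (fun _ => C) x = 0 := by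
  rw [leftOp, (hasSum_mul_const hw C).tsum_eq, mul_zero]

theorem rightOp_const {w : ℕ → ℝ} (hw : HasSum w 0 (conditional ℕ)) (α r h C x : ℝ) :
    rightOp α w r h (fun _ => C) x = 0 := by
  rw [rightOp, (hasSum_mul_const hw C).tsum_eq, mul_zero]

theorem hasLeftLimit_const {w : ℕ → ℝ} (hw : HasSum w 0 (conditional ℕ)) (α r C x : ℝ) :
    HasLeftLimit α w r (fun _ => C) x 0 := by
  refine ⟨Eventually.of_forall fun h => leftConv_const hw r h C x, ?_⟩
  simp only [leftOp_const hw]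
  exact tendsto_const_nhds

theorem hasRightLimit_const {w : ℕ → ℝ} (hw : HasSum w 0 (conditional ℕ)) (α r C x : ℝ) :
    HasRightLimit α w r (fun _ => C) x 0 := by
  refine ⟨Eventually.of_forall fun h => rightConv_const hw r h C x, ?_⟩
  simp only [rightOp_const hw]
  exact tendsto_const_nhds

/-! ### The exponential function, cut off on the right -/

/-- A smooth function that equals `exp` on `(-∞, 0]` and vanishes on `[1, ∞)`. -/
noncomputable def cutExp (x : ℝ) : ℝ := Real.exp x * Real.smoothTransition (1 - x)

theorem cutExp_of_nonpos {x : ℝ} (hx : x ≤ 0) : cutExp x = Real.exp x := by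
  rw [cutExp, Real.smoothTransition.one_of_one_le (by linarith), mul_one]

theorem cutExp_of_one_le {x : ℝ} (hx : 1 ≤ x) : cutExp x = 0 := by
  rw [cutExp, Real.smoothTransition.zero_of_nonpos (by linarith), mul_zero]

theorem contDiff_cutExp (s : ℕ) : ContDiff ℝ s cutExp :=
  Real.contDiff_exp.mul ((Real.smoothTransition.contDiff (n := s)).comp
    (contDiff_const.sub contDiff_id))

theorem integrable_iteratedDeriv_cutExp (k : ℕ) : Integrable (iteratedDeriv k cutExp) := by
  have hcont : Continuous (iteratedDeriv k cutExp) :=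
    (contDiff_cutExp k).continuous_iteratedDeriv k le_rfl
  -- The half-lines are open so that `cutExp` agrees with `exp`, or with `0`, near each point and
  -- all derivatives agree too; on the compact middle piece continuity suffices.
  have h0 : IntegrableOn (iteratedDeriv k cutExp) (Set.Iio 0) := by
    refine ((integrableOn_exp_Iic 0).mono_set Set.Iio_subset_Iic_self).congr_fun ?_
      measurableSet_Iio
    intro x hx
    have he : cutExp =ᶠ[𝓝 x] Real.exp :=
      (eventually_lt_nhds (Set.mem_Iio.1 hx)).mono fun y hy => cutExp_of_nonpos hy.le
    simp only [he.iteratedDeriv_eq k, iteratedDeriv_eq_iterate, Real.iter_deriv_exp]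
  have h1 : IntegrableOn (iteratedDeriv k cutExp) (Set.Icc 0 1) :=
    hcont.continuousOn.integrableOn_Icc
  have h2 : IntegrableOn (iteratedDeriv k cutExp) (Set.Ioi 1) := by
    refine (integrableOn_zero (ε' := ℝ)).congr_fun ?_ measurableSet_Ioi
    intro x hx
    have he : cutExp =ᶠ[𝓝 x] fun _ => (0 : ℝ) :=
      (eventually_gt_nhds (Set.mem_Ioi.1 hx)).mono fun y hy => cutExp_of_one_le hy.le
    simp [he.iteratedDeriv_eq k]
  rw [← integrableOn_univ]
  refine ((h0.union h1).union h2).mono_set fun x _ => ?_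
  rcases lt_or_ge x 0 with hx | hx
  · exact Or.inl (Or.inl hx)
  · rcases le_or_gt x 1 with hx' | hx'
    · exact Or.inl (Or.inr ⟨hx, hx'⟩)
    · exact Or.inr hx'

theorem admissible_cutExp (s : ℕ) : Admissible s cutExp :=
  ⟨contDiff_cutExp s, fun k _ => integrable_iteratedDeriv_cutExp k⟩

/-- The rightmost node is `x + r * h`, so no node meets the cutoff, and the exponential turns the
equispaced nodes into powers of `exp (-h)`. -/
theorem leftTerm_cutExp (w : ℕ → ℝ) {r h x : ℝ} (hh : 0 < h) (hx : x + r * h ≤ 0) :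
    (fun k : ℕ => w k * cutExp (x - ((k : ℝ) - r) * h)) =
      fun k => Real.exp (x + r * h) * (w k * Real.exp (-h) ^ k) := by
  ext k
  have hk : 0 ≤ (k : ℝ) * h := by positivity
  rw [cutExp_of_nonpos (by linarith), ← Real.exp_nat_mul,
    show x - ((k : ℝ) - r) * h = x + r * h + k * -h by ring, Real.exp_add]
  ring

theorem tendsto_one_sub_exp_neg_div :
    Tendsto (fun h : ℝ => (1 - Real.exp (-h)) / h) (𝓝[>] 0) (𝓝 1) := by
  have hd : HasDerivAt (fun h : ℝ => 1 - Real.exp (-h)) 1 0 := by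
    simpa using ((hasDerivAt_id (0 : ℝ)).neg.exp).const_sub 1
  have := (hasDerivAt_iff_tendsto_slope.1 hd).mono_left (nhdsGT_le_nhdsNE 0)
  refine this.congr fun h => ?_
  simp [slope_def_field]

/-- On `(-∞, 0]` the left fractional derivative of `cutExp` is `exp`. -/
theorem hasLeftGLDeriv_cutExp (α : ℝ) {x : ℝ} (hx : x ≤ 0) :
    HasLeftGLDeriv α cutExp x (Real.exp x) := by
  have hsum : ∀ h : ℝ, 0 < h → HasSum (fun k : ℕ => glCoeff α k * cutExp (x - ((k : ℝ) - 0) * h))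
      (Real.exp x * (1 - Real.exp (-h)) ^ α) (conditional ℕ) := by
    intro h hh
    have h1 := leftTerm_cutExp (glCoeff α) (r := 0) hh (by simpa using hx)
    rw [h1, zero_mul, add_zero]
    have h2 := hasSum_glCoeff_mul_pow α (t := Real.exp (-h))
      (by rw [abs_of_pos (Real.exp_pos _)]; exact Real.exp_lt_one_iff.2 (by linarith))
    exact hasSum_conditional_nat_iff.2 (h2.mul_left (Real.exp x)).tendsto_sum_nat
  refine ⟨?_, ?_⟩
  · filter_upwards [self_mem_nhdsWithin] with h hh using (hsum h hh).summable
  · have h1 : Tendsto (fun h : ℝ => Real.exp x * ((1 - Real.exp (-h)) / h) ^ α) (𝓝[>] 0)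
        (𝓝 (Real.exp x * 1 ^ α)) :=
      (tendsto_one_sub_exp_neg_div.rpow_const (Or.inl one_ne_zero)).const_mul _
    rw [Real.one_rpow, mul_one] at h1
    refine h1.congr' ?_
    filter_upwards [self_mem_nhdsWithin] with h hh
    have hh' : 0 < h := hh
    have hle : 0 ≤ 1 - Real.exp (-h) := by
      have := Real.exp_lt_one_iff.2 (show -h < 0 by linarith)
      linarith
    rw [leftOp, (hsum h hh).tsum_eq, Real.div_rpow hle hh'.le]
    ring

/-! ### Consequences of consistency -/

/-- The generating series of consistent weights converges at `exp (-h)` for all small `h > 0`, and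
its sum tends to zero as `h → 0+`. -/
theorem Consistent.genFun_exp_neg {α r : ℝ} {w : ℕ → ℝ} {s : ℕ} (hα : 0 < α)
    (hw : Consistent α w r s) :
    (∀ᶠ h in 𝓝[>] (0 : ℝ), Summable (fun k : ℕ => w k * Real.exp (-h) ^ k) (conditional ℕ)) ∧
      Tendsto (fun h : ℝ => ∑'[conditional ℕ] k : ℕ, w k * Real.exp (-h) ^ k) (𝓝[>] 0) (𝓝 0) := by
  -- This base point keeps `x + r * h ≤ 0` for all `0 < h ≤ 1`, whatever the sign of the shift.
  set x := -|r|
  obtain ⟨hconv, hlim⟩ := (hw cutExp (admissible_cutExp s) x (Real.exp x)).1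
    (hasLeftGLDeriv_cutExp α (neg_nonpos.2 (abs_nonneg r)))
  have hsmall : ∀ᶠ h in 𝓝[>] (0 : ℝ), 0 < h ∧ x + r * h ≤ 0 := by
    filter_upwards [Ioc_mem_nhdsGT (zero_lt_one' ℝ)] with h hh
    refine ⟨hh.1, ?_⟩
    have h1 : r * h ≤ |r| * h := mul_le_mul_of_nonneg_right (le_abs_self r) hh.1.le
    have h2 : |r| * h ≤ |r| := mul_le_of_le_one_right (abs_nonneg r) hh.2
    simp only [x]
    linarith
  refine ⟨?_, ?_⟩
  · filter_upwards [hconv, hsmall] with h hc hs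
    rw [LeftConv, leftTerm_cutExp w hs.1 hs.2] at hc
    exact (summable_mul_left_iff (Real.exp_ne_zero _)).1 hc
  · have hpow : Tendsto (fun h : ℝ => h ^ α) (𝓝[>] 0) (𝓝 0) := by
      have := (Real.continuousAt_rpow_const 0 α (Or.inr hα.le)).tendsto
      rw [Real.zero_rpow hα.ne'] at this
      exact this.mono_left nhdsWithin_le_nhds
    have hexp : Tendsto (fun h : ℝ => Real.exp (-(x + r * h))) (𝓝[>] 0)
        (𝓝 (Real.exp (-(x + r * 0)))) :=
      ((by fun_prop : Continuous fun h : ℝ => Real.exp (-(x + r * h))).tendsto 0).mono_left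
        nhdsWithin_le_nhds
    -- Solved for the series, `W(e^{-h}) = h^α * exp (-(x + r * h)) * leftOp`; the last two factors
    -- have finite limits and the first tends to zero.
    have hmul := (hpow.mul hexp).mul hlim
    rw [zero_mul, zero_mul] at hmul
    refine hmul.congr' ?_
    filter_upwards [hsmall] with h hs
    rw [leftOp, leftTerm_cutExp w hs.1 hs.2, tsum_mul_left, Real.exp_neg]
    have h1 : h ^ α ≠ 0 := (Real.rpow_pos_of_pos hs.1 α).ne'
    have h2 := Real.exp_ne_zero (x + r * h)
    field_simp

/-- The generating series of consistent weights converges in the open unit disc. -/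
theorem Consistent.summable_genFun {α r : ℝ} {w : ℕ → ℝ} {s : ℕ} (hα : 0 < α)
    (hw : Consistent α w r s) {z : ℂ} (hz : ‖z‖ < 1) :
    Summable fun k : ℕ => (w k : ℂ) * z ^ k := by
  have hexp : Tendsto (fun h : ℝ => Real.exp (-h)) (𝓝[>] 0) (𝓝 (Real.exp (-0))) :=
    ((by fun_prop : Continuous fun h : ℝ => Real.exp (-h)).tendsto 0).mono_left nhdsWithin_le_nhds
  rw [neg_zero, Real.exp_zero] at hexp
  -- A small `h` puts `exp (-h)` strictly between `‖z‖` and `1`, at a point of convergence.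
  obtain ⟨h, hs, hlt⟩ := ((hw.genFun_exp_neg hα).1.and (hexp.eventually_const_lt hz)).exists
  exact summable_of_summable_conditional_pow hs (by rwa [abs_of_pos (Real.exp_pos _)])

/-- Real form of `lim_{t → 1-} W(t) = 0` for consistent weights. -/
theorem Consistent.tendsto_tsum {α r : ℝ} {w : ℕ → ℝ} {s : ℕ} (hα : 0 < α)
    (hw : Consistent α w r s) :
    Tendsto (fun t : ℝ => ∑' k : ℕ, w k * t ^ k) (𝓝[<] 1) (𝓝 0) := by
  have hlog : Tendsto (fun t : ℝ => -Real.log t) (𝓝[<] 1) (𝓝[>] 0) := by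
    refine tendsto_nhdsWithin_iff.2 ⟨?_, ?_⟩
    · have := (Real.continuousAt_log one_ne_zero).tendsto.neg
      rw [Real.log_one, neg_zero] at this
      exact this.mono_left nhdsWithin_le_nhds
    · filter_upwards [Ioo_mem_nhdsLT (zero_lt_one' ℝ)] with t ht
      exact neg_pos.2 (Real.log_neg ht.1 ht.2)
  refine ((hw.genFun_exp_neg hα).2.comp hlog).congr' ?_
  filter_upwards [Ioo_mem_nhdsLT (zero_lt_one' ℝ)] with t ht
  have hsum : Summable fun k : ℕ => w k * t ^ k := by
    have := hw.summable_genFun hα (z := t) (by simpa [abs_of_pos ht.1] using ht.2)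
    exact_mod_cast this
  simp only [Function.comp_apply, neg_neg, Real.exp_log ht.1]
  -- For `t < 1` convergence is absolute, so the limit of partial sums is the unconditional sum.
  exact tsum_eq_of_summable_unconditional hsum

theorem Consistent.tendsto_genFun {α r : ℝ} {w : ℕ → ℝ} {s : ℕ} (hα : 0 < α)
    (hw : Consistent α w r s) :
    Tendsto (fun t : ℝ => genFun w (t : ℂ)) (𝓝[<] 1) (𝓝 0) := by
  have h := (Complex.continuous_ofReal.tendsto 0).comp (hw.tendsto_tsum hα)
  rw [Complex.ofReal_zero] at h
  refine h.congr' ?_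
  filter_upwards [Ioo_mem_nhdsLT (zero_lt_one' ℝ)] with t ht
  have hsum : Summable fun k : ℕ => w k * t ^ k := by
    have := hw.summable_genFun hα (z := t) (by simpa [abs_of_pos ht.1] using ht.2)
    exact_mod_cast this
  exact (genFun_ofReal (hasSum_conditional_nat_iff.2 hsum.hasSum.tendsto_sum_nat)).symm

/-- If the series of consistent weights converges, its sum is zero. -/
theorem Consistent.hasSum_zero {α r : ℝ} {w : ℕ → ℝ} {s : ℕ} (hα : 0 < α)
    (hw : Consistent α w r s) (hs : Summable w (conditional ℕ)) :
    HasSum w 0 (conditional ℕ) := by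
  obtain ⟨a, ha⟩ := hs
  -- Abel's limit theorem: the power series tends to `a` as `t → 1-`, and consistency says this
  -- limit is `0`.
  have habel := Real.tendsto_tsum_powerSeries_nhdsWithin_lt (hasSum_conditional_nat_iff.1 ha)
  rwa [tendsto_nhds_unique habel (hw.tendsto_tsum hα)] at ha

end Grunwald

theorem mainTheorem9 (α : ℝ) (n : ℕ) (hn : 1 ≤ n) (hα : (n : ℝ) - 1 < α) (hα' : α ≤ n)
    (m : ℕ) (r : ℝ) (w : ℕ → ℝ) (hw : Grunwald.Consistent α w r (m + n + 1)) :
    -- `W` converges in the open unit disc and `W(1) = lim_{t → 1-} W(t) = 0`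
    ((∀ z : ℂ, ‖z‖ < 1 → Summable fun k : ℕ => (w k : ℂ) * z ^ k) ∧
      Tendsto (fun t : ℝ => Grunwald.genFun w (t : ℂ)) (𝓝[<] 1) (𝓝 0)) ∧
    -- if the series of the weights converges (that is, if `W` converges at `1`):
    (Summable w (conditional ℕ) →
      Grunwald.genFun w 1 = 0 ∧
      HasSum w 0 (conditional ℕ) ∧
      -- the approximated fractional derivatives of a constant, and their limits, are zero
      ∀ C x : ℝ,
        (∀ h : ℝ, 0 < h →
          (Grunwald.LeftConv w r h (fun _ => C) x ∧
            Grunwald.leftOp α w r h (fun _ => C) x = 0) ∧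
          (Grunwald.RightConv w r h (fun _ => C) x ∧
            Grunwald.rightOp α w r h (fun _ => C) x = 0)) ∧
        Grunwald.HasLeftLimit α w r (fun _ => C) x 0 ∧
        Grunwald.HasRightLimit α w r (fun _ => C) x 0) ∧
    -- the fractional derivatives of a constant are zero
    (∀ C x : ℝ, Grunwald.HasLeftGLDeriv α (fun _ => C) x 0 ∧
      Grunwald.HasRightGLDeriv α (fun _ => C) x 0) := by

  have hα₀ : 0 < α := by
    have : (1 : ℝ) ≤ n := by exact_mod_cast hn
    linarith
  refine ⟨⟨fun z hz => hw.summable_genFun hα₀ hz, hw.tendsto_genFun hα₀⟩, fun hs => ?_,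
    fun C x => ⟨Grunwald.hasLeftLimit_const (Grunwald.hasSum_glCoeff hα₀) α 0 C x,
      Grunwald.hasRightLimit_const (Grunwald.hasSum_glCoeff hα₀) α 0 C x⟩⟩
  have h0 := hw.hasSum_zero hα₀ hs
  refine ⟨?_, h0, fun C x => ⟨fun h _ => ⟨⟨Grunwald.leftConv_const h0 r h C x,
    Grunwald.leftOp_const h0 α r h C x⟩, Grunwald.rightConv_const h0 r h C x,
    Grunwald.rightOp_const h0 α r h C x⟩, Grunwald.hasLeftLimit_const h0 α r C x,
    Grunwald.hasRightLimit_const h0 α r C x⟩⟩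
  simpa using Grunwald.genFun_ofReal (w := w) (t := 1) (a := 0) (by simpa using h0)
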